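/- For a positive integer $n$ let $p(n)$ be the number of partitions of $n$, and let $p^{(3)}(n)$ be the number of partitions $\lambda_1\ge\lambda_2\ge\cdots$ of $n$ with $\lambda_1\ge 3\lambda_2$, where the partition $[n]$ with the single part $n$ is counted. Consider the following program with input $n$, which uses integer variables $k,x,y,t,u,p,q$ and an integer array $a$ (the numbers $p(n)$, $p^{(3)}(n)$ are not to be confused with the variable $p$), and in which "visit $a_1,\dots,a_j$" outputs the list $a_1,\dots,a_j$: $k\leftarrow 1$; $x\leftarrow 1$; $y\leftarrow n-1$; **while** $k>0$ **do** - **while** $3x\le y$ **do** $\{\,a_k\leftarrow x$; $y\leftarrow y-x$; $k\leftarrow k+1\,\}$; - $t\leftarrow k+1$; $u\leftarrow k+2$; - **while** $2x\le y$ **do** $\{\,a_k\leftarrow x$; $a_t\leftarrow x$; $a_u\leftarrow y-x$; visit $a_1,\dots,a_u$; $p\leftarrow x+1$; $q\leftarrow y-p$; **while** $p\le q$ **do** $\{\,a_t\leftarrow p$; $a_u\leftarrow q$; visit $a_1,\dots,a_u$; $p\leftarrow p+1$; $q\leftarrow q-1\,\}$; $a_t\leftarrow y$; visit $a_1,\dots,a_t$;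 $x\leftarrow x+1$; $y\leftarrow y-1\,\}$; - **while** $x\le y$ **do** $\{\,a_k\leftarrow x$; $a_t\leftarrow y$; visit $a_1,\dots,a_t$; $x\leftarrow x+1$; $y\leftarrow y-1\,\}$; - $y\leftarrow x+y-1$; $a_k\leftarrow y+1$; visit $a_1,\dots,a_k$; $k\leftarrow k-1$; $x\leftarrow a_k+1$. (The last five statements are the end of the body of the outermost loop. The array has an entry $a_0$, whose value is arbitrary; it is read only in the last statement executed.) For every positive integer $n$ and all initial contents of the memory, the program terminates, and until then it executes exactly $4p(n)+5p^{(3)}(n)$ assignment statements and evaluates exactly $p(n)+4p^{(3)}(n)$ boolean expressions (each evaluation of a loop condition, including the final failing one, counts once). -/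

import Mathlib

namespace PartitionGen

/-- The integer program variables; `n` holds the input. -/
inductive Var where
  | n | k | x | y | t | u | p | q
  deriving DecidableEq

/-- Integer expressions; `arr e` is the array entry `a_e`. -/
inductive Expr where
  | const (c : ℤ)
  | var (v : Var)
  | arr (e : Expr)
  | add (e₁ e₂ : Expr)
  | sub (e₁ e₂ : Expr)
  | mul (e₁ e₂ : Expr)

/-- Boolean expressions. -/
inductive BExpr where
  | le (e₁ e₂ : Expr)
  | gt (e₁ e₂ : Expr)

/-- Statements. `assign v e` is `v ← e`, `assignArr i e` is `a_i ← e`,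
`visit e` visits (outputs) `a_1, …, a_e`, `loop b c` is `while b do c`. -/
inductive Stmt where
  | assign (v : Var) (e : Expr)
  | assignArr (i e : Expr)
  | visit (e : Expr)
  | seq (c₁ c₂ : Stmt)
  | loop (b : BExpr) (c : Stmt)

infixr:60 " ;; " => Stmt.seq

/-- A memory state: the values of the variables, the array `a`, and the list of everything visited
so far. -/
structure State where
  val : Var → ℤ
  a : ℤ → ℤ
  out : List (List ℤ)

/-- The value of an integer expression. -/
def Expr.eval (σ : State) : Expr → ℤ
  | .const c => c
  | .var v => σ.val v
  | .arr e => σ.a (e.eval σ)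
  | .add e₁ e₂ => e₁.eval σ + e₂.eval σ
  | .sub e₁ e₂ => e₁.eval σ - e₂.eval σ
  | .mul e₁ e₂ => e₁.eval σ * e₂.eval σ

/-- Truth of a boolean expression. -/
def BExpr.Holds (σ : State) : BExpr → Prop
  | .le e₁ e₂ => e₁.eval σ ≤ e₂.eval σ
  | .gt e₁ e₂ => e₁.eval σ > e₂.eval σ

/-- Big-step semantics with counters: `Exec c σ σ' A B` says that running `c` from the state `σ`
terminates in the state `σ'`, after executing exactly `A` assignment statements and evaluating
boolean expressions exactly `B` times. -/
inductive Exec : Stmt → State → State → ℕ → ℕ → Prop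
  | assign (v : Var) (e : Expr) (σ : State) :
      Exec (.assign v e) σ { σ with val := Function.update σ.val v (e.eval σ) } 1 0
  | assignArr (i e : Expr) (σ : State) :
      Exec (.assignArr i e) σ { σ with a := Function.update σ.a (i.eval σ) (e.eval σ) } 1 0
  | visit (e : Expr) (σ : State) :
      Exec (.visit e) σ
        { σ with out := σ.out ++
            [(List.range (e.eval σ).toNat).map fun i => σ.a ((i : ℤ) + 1)] } 0 0
  | seq {c₁ c₂ : Stmt} {σ σ' σ'' : State} {A B A' B' : ℕ}
      (h₁ : Exec c₁ σ σ' A B) (h₂ : Exec c₂ σ' σ'' A' B') :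
      Exec (.seq c₁ c₂) σ σ'' (A + A') (B + B')
  | loopFalse {b : BExpr} {c : Stmt} {σ : State} (hb : ¬ b.Holds σ) :
      Exec (.loop b c) σ σ 0 1
  | loopTrue {b : BExpr} {c : Stmt} {σ σ' σ'' : State} {A B A' B' : ℕ}
      (hb : b.Holds σ) (h₁ : Exec c σ σ' A B) (h₂ : Exec (.loop b c) σ' σ'' A' B') :
      Exec (.loop b c) σ σ'' (A + A') (1 + B + B')

/-- The loop `while 3x ≤ y`. -/
def pushLoop : Stmt :=
  .loop (.le (.mul (.const 3) (.var .x)) (.var .y)) (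
    .assignArr (.var .k) (.var .x) ;;
    .assign .y (.sub (.var .y) (.var .x)) ;;
    .assign .k (.add (.var .k) (.const 1)))

/-- The loop `while p ≤ q`. -/
def innerLoop : Stmt :=
  .loop (.le (.var .p) (.var .q)) (
    .assignArr (.var .t) (.var .p) ;;
    .assignArr (.var .u) (.var .q) ;;
    .visit (.var .u) ;;
    .assign .p (.add (.var .p) (.const 1)) ;;
    .assign .q (.sub (.var .q) (.const 1)))

/-- The loop `while 2x ≤ y`. -/
def middleLoop : Stmt :=
  .loop (.le (.mul (.const 2) (.var .x)) (.var .y)) (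
    .assignArr (.var .k) (.var .x) ;;
    .assignArr (.var .t) (.var .x) ;;
    .assignArr (.var .u) (.sub (.var .y) (.var .x)) ;;
    .visit (.var .u) ;;
    .assign .p (.add (.var .x) (.const 1)) ;;
    .assign .q (.sub (.var .y) (.var .p)) ;;
    innerLoop ;;
    .assignArr (.var .t) (.var .y) ;;
    .visit (.var .t) ;;
    .assign .x (.add (.var .x) (.const 1)) ;;
    .assign .y (.sub (.var .y) (.const 1)))

/-- The loop `while x ≤ y`. -/
def lastLoop : Stmt :=
  .loop (.le (.var .x) (.var .y)) (
    .assignArr (.var .k) (.var .x) ;;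
    .assignArr (.var .t) (.var .y) ;;
    .visit (.var .t) ;;
    .assign .x (.add (.var .x) (.const 1)) ;;
    .assign .y (.sub (.var .y) (.const 1)))

/-- The loop `while k > 0`. -/
def mainLoop : Stmt :=
  .loop (.gt (.var .k) (.const 0)) (
    pushLoop ;;
    .assign .t (.add (.var .k) (.const 1)) ;;
    .assign .u (.add (.var .k) (.const 2)) ;;
    middleLoop ;;
    lastLoop ;;
    .assign .y (.sub (.add (.var .x) (.var .y)) (.const 1)) ;;
    .assignArr (.var .k) (.add (.var .y) (.const 1)) ;;
    .visit (.var .k) ;;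
    .assign .k (.sub (.var .k) (.const 1)) ;;
    .assign .x (.add (.arr (.var .k)) (.const 1)))

/-- The accelerated generator of ascending compositions. -/
def accelGen : Stmt :=
  .assign .k (.const 1) ;;
  .assign .x (.const 1) ;;
  .assign .y (.sub (.var .n) (.const 1)) ;;
  mainLoop

/-- `p(n)`, the number of partitions of `n`. -/
def numPartitions (n : ℕ) : ℕ := Fintype.card (Nat.Partition n)

/-- `part l i` is the `(i+1)`-st largest part of `l` (with multiplicity), and `0` if `l` has at most
`i` parts. -/
def part {n : ℕ} (l : Nat.Partition n) (i : ℕ) : ℕ := (l.parts.sort (· ≥ ·)).getD i 0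

/-- `p^{(t)}(n)`, the number of partitions of `n` whose largest part is at least `t` times the
second largest one; a partition with a single part is counted. -/
def numPartitionsRatio (t n : ℕ) : ℕ :=
  Fintype.card {l : Nat.Partition n // t * part l 1 ≤ part l 0}

end PartitionGen

/-!
Write `s = x + y` for the amount still to be distributed at level `k`, where the parts still to be
chosen must be at least `x = m`. Let `V` be the number of partitions of `s` into parts at least `m`
(`countAll`) and `M` the number of those whose largest part is at least three times the second
largest (`countParts (Dominates 3)`). The proof shows that the main loop, entered at level `k`,
returns to level `k - 1` after `4 V + 5 M - 3` assignments and `V + 4 M - 1` tests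
(`mainLoop_spec`). For `k = 1`, `m = 1`, `s = n`, the three initial assignments and the last test
of `k > 0` give the totals.

Both numbers obey the recursion on whether `m` occurs as a part,
`count m s = count m (s - m) + count (m + 1) s` (`countParts_rec`). For `M` it needs `4 m ≤ s`:
adding the smallest part `m` to a partition of `s - m` affects the second largest part only if
the result is `[s - m, m]`, and then `3 m ≤ s - m` makes that partition qualify as well. Since
`4 m ≤ s` is the test `3 x ≤ y` for a push, this is how the main loop proceeds: a push (three
assignments, one test) reduces to `(m, s - m)` one level up, and the return to level `k` leaves
`(m + 1, s)` (`mainLoop_push`). If `s < 4 m`, only the one-part partition is counted, so `M = 1`,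
and a single pass of the main loop does everything (`mainLoop_no_push`); there the partitions have
at most three parts, and the inner loops spend four assignments and one test on each of them apart
from the last, `[s]`. These costs come from the same recursion for `V`, together with `V = 1` for
`m ≤ s < 2 m`.

The semantics is deterministic (`Exec.deterministic`), so the counters of this one run are those of
every run.
-/

namespace PartitionGen

/-! ### Partitions with parts bounded below -/

/-- The number of partitions of `s` with all parts at least `m` and with property `Q`. The property
is one of multisets, so that it can be compared between partitions of different numbers. -/
def countParts (Q : Multiset ℕ → Prop) [DecidablePred Q] (m s : ℕ) : ℕ :=
  (Finset.univ.filter fun l : Nat.Partition s => (∀ i ∈ l.parts, m ≤ i) ∧ Q l.parts).card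

/-- Partitions of `s` into parts `≥ m` are split by whether `m` occurs; one copy of `m` can be
removed if it does. -/
theorem countParts_rec (Q : Multiset ℕ → Prop) [DecidablePred Q] {m s : ℕ} (hm : 1 ≤ m)
    (hms : m ≤ s)
    (hQ : ∀ P : Multiset ℕ, P.sum = s - m → (∀ i ∈ P, m ≤ i) → (Q (m ::ₘ P) ↔ Q P)) :
    countParts Q m s = countParts Q m (s - m) + countParts Q (m + 1) s := by
  unfold countParts
  rw [← Finset.card_filter_add_card_filter_not (fun l : Nat.Partition s => m ∈ l.parts)]
  congr 1
  · symm
    refine Finset.card_bij'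
      (fun l _ => ⟨m ::ₘ l.parts, ?_, ?_⟩) (fun l h => ⟨l.parts.erase m, ?_, ?_⟩) ?_ ?_ ?_ ?_
    · intro i hi
      rcases Multiset.mem_cons.1 hi with rfl | hi
      exacts [hm, l.parts_pos hi]
    · rw [Multiset.sum_cons, l.parts_sum]; omega
    · exact fun hi => l.parts_pos (Multiset.mem_of_mem_erase hi)
    · have h1 := Multiset.sum_erase (Finset.mem_filter.1 h).2
      rw [l.parts_sum] at h1
      omega
    · intro l h
      simp only [Finset.mem_filter, Finset.mem_univ, true_and] at h ⊢
      exact ⟨⟨by simpa using h.1, (hQ _ l.parts_sum h.1).2 h.2⟩, Multiset.mem_cons_self _ _⟩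
    · intro l h
      simp only [Finset.mem_filter, Finset.mem_univ, true_and] at h ⊢
      have hge : ∀ i ∈ l.parts.erase m, m ≤ i := fun i hi => h.1.1 i (Multiset.mem_of_mem_erase hi)
      have h1 := Multiset.sum_erase h.2
      rw [l.parts_sum] at h1
      refine ⟨hge, (hQ _ (by omega) hge).1 ?_⟩
      rw [Multiset.cons_erase h.2]
      exact h.1.2
    · intro l h
      exact Nat.Partition.ext (by simp)
    · intro l h
      exact Nat.Partition.ext (Multiset.cons_erase (Finset.mem_filter.1 h).2)
  · congr 1
    ext l
    simp only [Finset.mem_filter, Finset.mem_univ, true_and]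
    constructor
    · rintro ⟨⟨h1, h2⟩, h3⟩
      exact ⟨fun i hi => lt_of_le_of_ne (h1 i hi) (fun h => h3 (h ▸ hi)), h2⟩
    · rintro ⟨h1, h2⟩
      exact ⟨⟨fun i hi => (Nat.le_succ m).trans (h1 i hi), h2⟩,
        fun h => absurd (h1 m h) (by omega)⟩

/-- If only the one-part partition qualifies, there is exactly one partition to count. -/
theorem countParts_eq_one (Q : Multiset ℕ → Prop) [DecidablePred Q] {m s : ℕ} (hm : 1 ≤ m)
    (hms : m ≤ s) (hQs : Q {s})
    (hQ : ∀ P : Multiset ℕ, P.sum = s → (∀ i ∈ P, m ≤ i) → Q P → P.card ≤ 1) :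
    countParts Q m s = 1 := by
  unfold countParts
  rw [Finset.card_eq_one]
  refine ⟨Nat.Partition.indiscrete s, ?_⟩
  have hpi : (Nat.Partition.indiscrete s).parts = {s} :=
    Nat.Partition.indiscrete_parts (by omega)
  ext l
  simp only [Finset.mem_filter, Finset.mem_univ, true_and, Finset.mem_singleton]
  constructor
  · rintro ⟨h1, h2⟩
    have hc := hQ _ l.parts_sum h1 h2
    have hs := l.parts_sum
    refine Nat.Partition.ext ?_
    rw [hpi]
    rcases Nat.le_one_iff_eq_zero_or_eq_one.1 hc with h0 | h0
    · rw [Multiset.card_eq_zero.1 h0, Multiset.sum_zero] at hs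
      omega
    · obtain ⟨a, ha⟩ := Multiset.card_eq_one.1 h0
      rw [ha, Multiset.sum_singleton] at hs
      rw [ha, hs]
  · rintro rfl
    rw [hpi]
    simpa using ⟨hms, hQs⟩

/-- The number of partitions of `s` with all parts at least `m`. -/
abbrev countAll (m s : ℕ) : ℕ := countParts (fun _ => True) m s

theorem countAll_rec {m s : ℕ} (hm : 1 ≤ m) (hms : m ≤ s) :
    countAll m s = countAll m (s - m) + countAll (m + 1) s :=
  countParts_rec _ hm hms fun _ _ _ => Iff.rfl

theorem countAll_eq_one {m s : ℕ} (hm : 1 ≤ m) (hms : m ≤ s) (h : s < 2 * m) :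
    countAll m s = 1 := by
  refine countParts_eq_one _ hm hms trivial fun P hP hge _ => ?_
  have := Multiset.card_nsmul_le_sum hge
  rw [hP, smul_eq_mul] at this
  by_contra hc
  nlinarith

theorem numPartitions_eq_countAll (n : ℕ) : numPartitions n = countAll 1 n := by
  unfold numPartitions countAll countParts
  rw [Finset.filter_true_of_mem, Finset.card_univ]
  exact fun l _ => ⟨fun i hi => l.parts_pos hi, trivial⟩

/-! ### Partitions whose largest part dominates -/

/-- The largest element of the multiset is at least `t` times the second largest one, missing
elements being read as `0`. -/
def Dominates (t : ℕ) (P : Multiset ℕ) : Prop :=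
  t * (P.sort (· ≥ ·)).getD 1 0 ≤ (P.sort (· ≥ ·)).getD 0 0

instance (t : ℕ) : DecidablePred (Dominates t) := fun _ => by
  unfold Dominates; infer_instance

theorem dominates_singleton (t s : ℕ) : Dominates t {s} := by
  simp [Dominates]

theorem sort_cons_of_le {m : ℕ} {P : Multiset ℕ} (h : ∀ i ∈ P, m ≤ i) :
    (m ::ₘ P).sort (· ≥ ·) = P.sort (· ≥ ·) ++ [m] := by
  refine List.Perm.eq_of_pairwise' (r := (· ≥ ·)) (Multiset.pairwise_sort _ _) ?_ ?_
  · rw [List.pairwise_append]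
    refine ⟨Multiset.pairwise_sort _ _, List.pairwise_singleton _ _, ?_⟩
    intro a ha b hb
    rw [List.mem_singleton.1 hb]
    exact h a ((Multiset.mem_sort _).1 ha)
  · rw [← Multiset.coe_eq_coe, ← Multiset.coe_add]
    simp only [Multiset.sort_eq]
    rw [add_comm]
    rfl

/-- Adding the smallest part `m` changes the second largest part only of the one-part partition
`[s - m]`, and there `hs` makes the new inequality hold. -/
theorem dominates_cons {t m s : ℕ} (hm : 1 ≤ m) (hs : (t + 1) * m ≤ s) (ht : 1 ≤ t)
    {P : Multiset ℕ} (hP : P.sum = s - m) (hge : ∀ i ∈ P, m ≤ i) :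
    Dominates t (m ::ₘ P) ↔ Dominates t P := by
  have hs' : t * m ≤ s - m := by rw [add_mul] at hs; omega
  have htm : 1 ≤ t * m := Nat.mul_pos ht hm
  have hsum : (P.sort (· ≥ ·)).sum = s - m := by
    rw [← hP, ← Multiset.sum_coe, Multiset.sort_eq]
  unfold Dominates
  rw [sort_cons_of_le hge]
  generalize P.sort (· ≥ ·) = L at *
  rcases L with _ | ⟨a, _ | ⟨b, l⟩⟩
  · rw [List.sum_nil] at hsum
    omega
  · rw [List.sum_singleton] at hsum
    simpa [hsum] using hs'
  · simp

theorem countDominates_rec {t m s : ℕ} (ht : 1 ≤ t) (hm : 1 ≤ m) (hs : (t + 1) * m ≤ s) :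
    countParts (Dominates t) m s =
      countParts (Dominates t) m (s - m) + countParts (Dominates t) (m + 1) s :=
  countParts_rec _ hm (by nlinarith) fun _ hP hge => dominates_cons hm hs ht hP hge

/-- A second part `b ≥ m` would force a largest part at least `t * m`, hence a sum of at least
`(t + 1) * m`. -/
theorem countDominates_eq_one {t m s : ℕ} (hm : 1 ≤ m) (hms : m ≤ s) (hs : s < (t + 1) * m) :
    countParts (Dominates t) m s = 1 := by
  refine countParts_eq_one _ hm hms (dominates_singleton t s) fun P hP hge hd => ?_
  have hsum : (P.sort (· ≥ ·)).sum = s := by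
    rw [← hP, ← Multiset.sum_coe, Multiset.sort_eq]
  have hmem : ∀ i ∈ P.sort (· ≥ ·), m ≤ i := fun i hi => hge i ((Multiset.mem_sort _).1 hi)
  rw [← Multiset.length_sort (r := (· ≥ ·))]
  unfold Dominates at hd
  generalize P.sort (· ≥ ·) = L at *
  rcases L with _ | ⟨a, _ | ⟨b, l⟩⟩
  · simp
  · simp
  · have hb : m ≤ b := hmem b (by simp)
    simp only [List.getD_cons_zero, List.getD_cons_succ, List.sum_cons] at hd hsum
    have := Nat.mul_le_mul_left t hb
    rw [add_mul, one_mul] at hs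
    omega

theorem numPartitionsRatio_eq_count (t n : ℕ) :
    numPartitionsRatio t n = countParts (Dominates t) 1 n := by
  unfold numPartitionsRatio countParts
  rw [Fintype.card_subtype]
  congr 1
  ext l
  simp only [Finset.mem_filter, Finset.mem_univ, true_and]
  exact ⟨fun h => ⟨fun i hi => l.parts_pos hi, h⟩, fun h => h.2⟩

/-! ### Determinism of the semantics -/

theorem Exec.deterministic {c : Stmt} {σ σ₁ σ₂ : State} {A₁ B₁ A₂ B₂ : ℕ}
    (h₁ : Exec c σ σ₁ A₁ B₁) (h₂ : Exec c σ σ₂ A₂ B₂) : σ₁ = σ₂ ∧ A₁ = A₂ ∧ B₁ = B₂ := by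
  induction h₁ generalizing σ₂ A₂ B₂ with
  | assign | assignArr | visit => cases h₂; exact ⟨rfl, rfl, rfl⟩
  | seq _ _ ih₁ ih₂ =>
    cases h₂ with
    | seq k₁ k₂ =>
      obtain ⟨rfl, rfl, rfl⟩ := ih₁ k₁
      obtain ⟨rfl, rfl, rfl⟩ := ih₂ k₂
      exact ⟨rfl, rfl, rfl⟩
  | loopFalse hb =>
    cases h₂ with
    | loopFalse => exact ⟨rfl, rfl, rfl⟩
    | loopTrue hb' => exact absurd hb' hb
  | loopTrue hb _ _ ih₁ ih₂ =>
    cases h₂ with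
    | loopFalse hb' => exact absurd hb hb'
    | loopTrue _ k₁ k₂ =>
      obtain ⟨rfl, rfl, rfl⟩ := ih₁ k₁
      obtain ⟨rfl, rfl, rfl⟩ := ih₂ k₂
      exact ⟨rfl, rfl, rfl⟩

theorem Exec.congr_cost {c : Stmt} {σ σ' : State} {A B A' B' : ℕ} (h : Exec c σ σ' A B)
    (hA : A = A') (hB : B = B') : Exec c σ σ' A' B' := hA ▸ hB ▸ h

/-! ### The three inner loops -/

theorem innerLoop_step {σ : State} (h : σ.val .p ≤ σ.val .q) (htu : σ.val .t < σ.val .u) :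
    ∃ σ₁ : State,
      (∀ σ' A B, Exec innerLoop σ₁ σ' A B → Exec innerLoop σ σ' (A + 4) (B + 1)) ∧
      σ₁.val .p = σ.val .p + 1 ∧ σ₁.val .q = σ.val .q - 1 ∧
      σ₁.val .k = σ.val .k ∧ σ₁.val .x = σ.val .x ∧ σ₁.val .y = σ.val .y ∧
      σ₁.val .t = σ.val .t ∧ σ₁.val .u = σ.val .u ∧ ∀ i < σ.val .t, σ₁.a i = σ.a i := by
  apply Exists.intro
  refine ⟨fun σ' A B hE => ?_, ?_⟩
  · exact Exec.congr_cost (Exec.loopTrue (b := .le (.var .p) (.var .q)) h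
      (.seq (.assignArr _ _ _) (.seq (.assignArr _ _ _) (.seq (.visit _ _)
        (.seq (.assign _ _ _) (.assign _ _ _))))) hE) (by omega) (by omega)
  · refine ⟨by simp [Expr.eval], by simp [Expr.eval], by simp [Expr.eval], by simp [Expr.eval],
      by simp [Expr.eval], by simp [Expr.eval], by simp [Expr.eval], fun i hi => ?_⟩
    simp [Expr.eval, hi.ne, (hi.trans htu).ne]

/-- Each pass of `while p ≤ q` accounts for the one partition of `p + q` with smallest part `p`
(only one since `q < 2 * p`), and the final failing test for the one-part partition. -/
theorem innerLoop_spec (d : ℕ) : ∀ (p q : ℕ) (σ : State), q < p + d → 1 ≤ p → q < 2 * p →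
    σ.val .p = p → σ.val .q = q → σ.val .t < σ.val .u →
    ∃ (σ' : State) (J : ℕ), Exec innerLoop σ σ' (4 * J) (J + 1) ∧ J + 1 = countAll p (p + q) ∧
      σ'.val .k = σ.val .k ∧ σ'.val .x = σ.val .x ∧ σ'.val .y = σ.val .y ∧
      σ'.val .t = σ.val .t ∧ σ'.val .u = σ.val .u ∧ ∀ i < σ.val .t, σ'.a i = σ.a i := by
  have base : ∀ (p q : ℕ) (σ : State), q < p → 1 ≤ p → σ.val .p = p → σ.val .q = q →
      ∃ (σ' : State) (J : ℕ), Exec innerLoop σ σ' (4 * J) (J + 1) ∧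
        J + 1 = countAll p (p + q) ∧
        σ'.val .k = σ.val .k ∧ σ'.val .x = σ.val .x ∧ σ'.val .y = σ.val .y ∧
        σ'.val .t = σ.val .t ∧ σ'.val .u = σ.val .u ∧ ∀ i < σ.val .t, σ'.a i = σ.a i := by
    intro p q σ hpq hp h1 h2
    refine ⟨σ, 0, Exec.loopFalse ?_, (countAll_eq_one hp (by omega) (by omega)).symm,
      rfl, rfl, rfl, rfl, rfl, fun _ _ => rfl⟩
    simp only [BExpr.Holds, Expr.eval, h1, h2]
    omega
  induction d with
  | zero => exact fun p q σ hpq hp _ h1 h2 _ => base p q σ hpq hp h1 h2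
  | succ d ih =>
    intro p q σ hpq hp hq h1 h2 htu
    rcases Nat.lt_or_ge q p with h | h
    · exact base p q σ h hp h1 h2
    obtain ⟨σ₁, hstep, e1, e2, e3, e4, e5, e6, e7, e8⟩ :=
      innerLoop_step (σ := σ) (by omega) htu
    obtain ⟨σ', J, hE, hJ, f3, f4, f5, f6, f7, f8⟩ :=
      ih (p + 1) (q - 1) σ₁ (by omega) (by omega) (by omega) (by omega) (by omega) (by omega)
    refine ⟨σ', J + 1, (hstep _ _ _ hE).congr_cost (by omega) (by omega), ?_, by omega, by omega,
      by omega, by omega, by omega, fun i hi => (f8 i (by omega)).trans (e8 i hi)⟩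
    rw [countAll_rec hp (by omega), countAll_eq_one (s := p + q - p) hp (by omega) (by omega), hJ,
      show p + 1 + (q - 1) = p + q by omega, add_comm]

theorem lastLoop_step {σ : State} (h : σ.val .x ≤ σ.val .y) (hkt : σ.val .k < σ.val .t) :
    ∃ σ₁ : State,
      (∀ σ' A B, Exec lastLoop σ₁ σ' A B → Exec lastLoop σ σ' (A + 4) (B + 1)) ∧
      σ₁.val .x = σ.val .x + 1 ∧ σ₁.val .y = σ.val .y - 1 ∧
      σ₁.val .k = σ.val .k ∧ σ₁.val .t = σ.val .t ∧ ∀ i < σ.val .k, σ₁.a i = σ.a i := by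
  apply Exists.intro
  refine ⟨fun σ' A B hE => ?_, ?_⟩
  · exact Exec.congr_cost (Exec.loopTrue (b := .le (.var .x) (.var .y)) h
      (.seq (.assignArr _ _ _) (.seq (.assignArr _ _ _) (.seq (.visit _ _)
        (.seq (.assign _ _ _) (.assign _ _ _))))) hE) (by omega) (by omega)
  · refine ⟨by simp [Expr.eval], by simp [Expr.eval], by simp [Expr.eval], by simp [Expr.eval],
      fun i hi => ?_⟩
    simp [Expr.eval, hi.ne, (hi.trans hkt).ne]

/-- Each pass of `while x ≤ y` accounts for the partition of `x + y` into `x` and `y`, which is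
the only one with smallest part `x` since `y < 2 * x`. -/
theorem lastLoop_spec (d : ℕ) : ∀ (m s : ℕ) (σ : State), s < 2 * m + d → 1 ≤ m → m ≤ s →
    s < 3 * m → σ.val .x = m → σ.val .y = s - m → σ.val .k < σ.val .t →
    ∃ (σ' : State) (J : ℕ), Exec lastLoop σ σ' (4 * J) (J + 1) ∧ J + 1 = countAll m s ∧
      σ'.val .x + σ'.val .y = s ∧
      σ'.val .k = σ.val .k ∧ σ'.val .t = σ.val .t ∧ ∀ i < σ.val .k, σ'.a i = σ.a i := by
  have base : ∀ (m s : ℕ) (σ : State), s < 2 * m → 1 ≤ m → m ≤ s → σ.val .x = m →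
      σ.val .y = s - m →
      ∃ (σ' : State) (J : ℕ), Exec lastLoop σ σ' (4 * J) (J + 1) ∧ J + 1 = countAll m s ∧
        σ'.val .x + σ'.val .y = s ∧
        σ'.val .k = σ.val .k ∧ σ'.val .t = σ.val .t ∧ ∀ i < σ.val .k, σ'.a i = σ.a i := by
    intro m s σ hs hm hms h1 h2
    refine ⟨σ, 0, Exec.loopFalse ?_, (countAll_eq_one hm hms hs).symm, by omega,
      rfl, rfl, fun _ _ => rfl⟩
    simp only [BExpr.Holds, Expr.eval, h1, h2]
    omega
  induction d with
  | zero => exact fun m s σ hs hm hms _ h1 h2 _ => base m s σ hs hm hms h1 h2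
  | succ d ih =>
    intro m s σ hs hm hms hs3 h1 h2 hkt
    rcases Nat.lt_or_ge s (2 * m) with h | h
    · exact base m s σ h hm hms h1 h2
    obtain ⟨σ₁, hstep, e1, e2, e3, e4, e5⟩ := lastLoop_step (σ := σ) (by omega) hkt
    obtain ⟨σ', J, hE, hJ, f1, f2, f3, f4⟩ :=
      ih (m + 1) s σ₁ (by omega) (by omega) (by omega) (by omega) (by omega) (by omega) (by omega)
    refine ⟨σ', J + 1, (hstep _ _ _ hE).congr_cost (by omega) (by omega), ?_, f1, by omega,
      by omega, fun i hi => (f4 i (by omega)).trans (e5 i hi)⟩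
    rw [countAll_rec hm hms, countAll_eq_one (s := s - m) hm (by omega) (by omega), hJ, add_comm]

/-- A pass of `while 2 * x ≤ y` treats the partitions with smallest part `x` of `x + y`: one
visit with `x` twice, one for each pass of the inner loop, and one for the two parts `x` and `y`.
-/
theorem middleLoop_step {m s : ℕ} {σ : State} (hm : 1 ≤ m) (hs : 3 * m ≤ s) (hs4 : s < 4 * m)
    (hx : σ.val .x = m) (hy : σ.val .y = s - m) (hkt : σ.val .k < σ.val .t)
    (htu : σ.val .t < σ.val .u) :
    ∃ (σ₁ : State) (C : ℕ),
      (∀ σ' A B, Exec middleLoop σ₁ σ' A B → Exec middleLoop σ σ' (A + 4 * C) (B + C)) ∧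
      C + countAll (m + 1) s = countAll m s ∧
      σ₁.val .x = m + 1 ∧ σ₁.val .y = s - m - 1 ∧
      σ₁.val .k = σ.val .k ∧ σ₁.val .t = σ.val .t ∧ σ₁.val .u = σ.val .u ∧
      ∀ i < σ.val .k, σ₁.a i = σ.a i := by
  -- The memory on entering the inner loop.
  let a₁ := Function.update σ.a (σ.val .k) (σ.val .x)
  let a₂ := Function.update a₁ (σ.val .t) (σ.val .x)
  let a₃ := Function.update a₂ (σ.val .u) (σ.val .y - σ.val .x)
  let v₁ := Function.update σ.val .p (σ.val .x + 1)
  let v₂ := Function.update v₁ .q (v₁ .y - v₁ .p)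
  let o : List (List ℤ) := σ.out ++ [(List.range (σ.val .u).toNat).map fun i => a₃ ((i : ℤ) + 1)]
  obtain ⟨σ₂, J, hE, hJ, f3, f4, f5, f6, f7, f8⟩ :=
    innerLoop_spec (s - 3 * m) (m + 1) (s - 2 * m - 1) ⟨v₂, a₃, o⟩ (by omega) (by omega)
      (by omega) (by simp [v₂, v₁, hx]) (by simp [v₂, v₁, hx, hy]; omega)
      (by simpa [v₂, v₁] using htu)
  simp only [v₂, v₁, ne_eq, reduceCtorEq, not_false_eq_true, Function.update_of_ne]
    at f3 f4 f5 f6 f7 f8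
  apply Exists.intro
  refine ⟨J + 2, fun σ' A B hT => ?_, ?_⟩
  · exact Exec.congr_cost (Exec.loopTrue (b := .le (.mul (.const 2) (.var .x)) (.var .y))
      (by simp only [BExpr.Holds, Expr.eval]; omega)
      (.seq (.assignArr _ _ _) (.seq (.assignArr _ _ _) (.seq (.assignArr _ _ _)
        (.seq (.visit _ _) (.seq (.assign _ _ _) (.seq (.assign _ _ _) (.seq hE
        (.seq (.assignArr _ _ _) (.seq (.visit _ _)
        (.seq (.assign _ _ _) (.assign _ _ _))))))))))) hT) (by omega) (by omega)
  · refine ⟨?_, by simp [Expr.eval, f4, hx], by simp [Expr.eval, f5, hy],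
      by simp [Expr.eval, f3], by simp [Expr.eval, f6], by simp [Expr.eval, f7], fun i hi => ?_⟩
    · rw [countAll_rec (s := s) hm (by omega), countAll_rec (s := s - m) hm (by omega),
        countAll_eq_one (s := s - m - m) hm (by omega) (by omega),
        show s - m = m + 1 + (s - 2 * m - 1) by omega, ← hJ]
      omega
    · have hit : i < σ.val .t := by omega
      have hiu : i < σ.val .u := by omega
      simp [Expr.eval, f6, f8 i hit, a₃, a₂, a₁, hi.ne, hit.ne, hiu.ne]

/-- The loop `while 2 * x ≤ y` raises `x` from `m` to some `m'` and spends four assignments and one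
test on each partition of `s` whose smallest part is at least `m` but less than `m'`, besides the
final test. -/
theorem middleLoop_spec (d : ℕ) : ∀ (m s : ℕ) (σ : State), s < 3 * m + d → 1 ≤ m → m ≤ s →
    s < 4 * m → σ.val .x = m → σ.val .y = s - m → σ.val .k < σ.val .t →
    σ.val .t < σ.val .u →
    ∃ (σ' : State) (C m' : ℕ), Exec middleLoop σ σ' (4 * C) (C + 1) ∧
      C + countAll m' s = countAll m s ∧ 1 ≤ m' ∧ m' ≤ s ∧ s < 3 * m' ∧
      σ'.val .x = m' ∧ σ'.val .y = s - m' ∧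
      σ'.val .k = σ.val .k ∧ σ'.val .t = σ.val .t ∧ ∀ i < σ.val .k, σ'.a i = σ.a i := by
  have base : ∀ (m s : ℕ) (σ : State), s < 3 * m → 1 ≤ m → m ≤ s → σ.val .x = m →
      σ.val .y = s - m →
      ∃ (σ' : State) (C m' : ℕ), Exec middleLoop σ σ' (4 * C) (C + 1) ∧
        C + countAll m' s = countAll m s ∧ 1 ≤ m' ∧ m' ≤ s ∧ s < 3 * m' ∧
        σ'.val .x = m' ∧ σ'.val .y = s - m' ∧
        σ'.val .k = σ.val .k ∧ σ'.val .t = σ.val .t ∧ ∀ i < σ.val .k, σ'.a i = σ.a i := by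
    intro m s σ hs hm hms h1 h2
    refine ⟨σ, 0, m, Exec.loopFalse ?_, zero_add _, hm, hms, hs, h1, h2,
      rfl, rfl, fun _ _ => rfl⟩
    simp only [BExpr.Holds, Expr.eval, h1, h2]
    omega
  induction d with
  | zero => exact fun m s σ hs hm hms _ h1 h2 _ _ => base m s σ hs hm hms h1 h2
  | succ d ih =>
    intro m s σ hs hm hms hs4 h1 h2 hkt htu
    rcases Nat.lt_or_ge s (3 * m) with h | h
    · exact base m s σ h hm hms h1 h2
    obtain ⟨σ₁, C₁, hstep, hC₁, e1, e2, e3, e4, e5, e6⟩ :=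
      middleLoop_step hm h hs4 h1 h2 hkt htu
    obtain ⟨σ', C, m', hE, hC, g1, g2, g3, f1, f2, f3, f4, f5⟩ :=
      ih (m + 1) s σ₁ (by omega) (by omega) (by omega) (by omega) (by omega) (by omega) (by omega)
        (by omega)
    exact ⟨σ', C + C₁, m', (hstep _ _ _ hE).congr_cost (by omega) (by omega), by omega, g1, g2, g3,
      f1, f2, by omega, by omega, fun i hi => (f5 i (by omega)).trans (e6 i hi)⟩

/-! ### The main loop -/

/-- A push can be split off the first pass of the main loop: the rest of that pass is the first
pass of the main loop from the state after the push. -/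
theorem mainLoop_push {σ : State} (hk : 0 < σ.val .k) (h : 3 * σ.val .x ≤ σ.val .y) :
    ∃ σ₁ : State,
      (∀ σ' A B, Exec mainLoop σ₁ σ' A B → Exec mainLoop σ σ' (A + 3) (B + 1)) ∧
      σ₁.val .x = σ.val .x ∧ σ₁.val .y = σ.val .y - σ.val .x ∧ σ₁.val .k = σ.val .k + 1 ∧
      σ₁.a (σ.val .k) = σ.val .x ∧ ∀ i < σ.val .k, σ₁.a i = σ.a i := by
  let σ₁ : State := ⟨Function.update (Function.update σ.val .y (σ.val .y - σ.val .x)) .k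
    (σ.val .k + 1), Function.update σ.a (σ.val .k) (σ.val .x), σ.out⟩
  have hpush : ∀ σ' A B, Exec pushLoop σ₁ σ' A B → Exec pushLoop σ σ' (A + 3) (B + 1) :=
    fun σ' A B hE => Exec.congr_cost (Exec.loopTrue
      (b := .le (.mul (.const 3) (.var .x)) (.var .y)) h
      (.seq (.assignArr _ _ _) (.seq (.assign _ _ _) (.assign _ _ _))) hE)
      (by omega) (by omega)
  refine ⟨σ₁, fun σ' A B hE => ?_, by simp [σ₁], by simp [σ₁], by simp [σ₁], by simp [σ₁],
    fun i hi => by simp [σ₁, hi.ne]⟩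
  have hk₁ : σ₁.val .k > 0 := by simp only [σ₁, Function.update_self]; omega
  unfold mainLoop at hE
  cases hE with
  | loopFalse hb => exact absurd hk₁ hb
  | loopTrue hb h₁ h₂ =>
    cases h₁ with
    | seq hp hr =>
      exact Exec.congr_cost (Exec.loopTrue (b := .gt (.var .k) (.const 0)) hk
        (.seq (hpush _ _ _ hp) hr) h₂) (by omega) (by omega)

/-- A pass of the main loop without a push deals with all partitions of `s` into parts at least
`m`. -/
theorem mainLoop_no_push {m s : ℕ} {σ : State} (hk : 0 < σ.val .k) (hm : 1 ≤ m) (hms : m ≤ s)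
    (hs : s < 4 * m) (hx : σ.val .x = m) (hy : σ.val .y = s - m) :
    ∃ σ₁ : State,
      (∀ σ' A B, Exec mainLoop σ₁ σ' A B →
        Exec mainLoop σ σ' (A + 4 * countAll m s + 2) (B + countAll m s + 3)) ∧
      σ₁.val .x = σ.a (σ.val .k - 1) + 1 ∧ σ₁.val .y = s - 1 ∧
      σ₁.val .k = σ.val .k - 1 ∧ ∀ i < σ.val .k, σ₁.a i = σ.a i := by
  let v₁ := Function.update σ.val .t (σ.val .k + 1)
  let v₂ := Function.update v₁ .u (v₁ .k + 2)
  obtain ⟨σ₂, C, m', hE₂, hC, g1, g2, g3, e1, e2, e3, e4, e5⟩ :=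
    middleLoop_spec (s - 2 * m) m s ⟨v₂, σ.a, σ.out⟩ (by omega) hm hms hs
      (by simp [v₂, v₁, hx]) (by simp [v₂, v₁, hy]) (by simp [v₂, v₁]) (by simp [v₂, v₁])
  simp only [v₂, v₁, ne_eq, reduceCtorEq, not_false_eq_true, Function.update_of_ne,
    Function.update_self] at e3 e4 e5
  obtain ⟨σ₃, J, hE₃, hJ, f1, f2, f3, f4⟩ :=
    lastLoop_spec (s - m') m' s σ₂ (by omega) g1 g2 g3 e1 e2 (by omega)
  have ha : ∀ i < σ.val .k, σ₃.a i = σ.a i := fun i hi => (f4 i (by omega)).trans (e5 i hi)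
  have hk₃ : σ₃.val .k = σ.val .k := by omega
  have hpush : Exec pushLoop σ σ 0 1 := Exec.loopFalse (by
    simp only [BExpr.Holds, Expr.eval]; omega)
  apply Exists.intro
  refine ⟨fun σ' A B hT => ?_, ?_⟩
  · exact Exec.congr_cost (Exec.loopTrue (b := .gt (.var .k) (.const 0)) hk
      (.seq hpush (.seq (.assign _ _ _) (.seq (.assign _ _ _) (.seq hE₂ (.seq hE₃
        (.seq (.assign _ _ _) (.seq (.assignArr _ _ _) (.seq (.visit _ _)
        (.seq (.assign _ _ _) (.assign _ _ _)))))))))) hT) (by omega) (by omega)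
  · refine ⟨?_, by simp [Expr.eval, f1], by simp [Expr.eval, hk₃], fun i hi => ?_⟩
    · simp [Expr.eval, hk₃, ha]
    · simp [Expr.eval, hk₃, hi.ne, ha i hi]

/-- Entered at level `k` with `x = m` and `x + y = s`, the main loop comes back to level `k - 1`
with `x` one above the entry `a_{k-1}` and `x + y` adjusted to match, which is the state needed to
go on with the next larger part there. The entries below `k` are unchanged. The cost is stated
through the remaining run from `σ₁` because a pass of the main loop can span several levels; the
additive terms `3` and `1` avoid subtraction. -/
theorem mainLoop_spec (N : ℕ) : ∀ (m s : ℕ) (σ : State), 2 * s ≤ N + m → 0 < σ.val .k → 1 ≤ m →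
    m ≤ s → σ.val .x = m → σ.val .y = s - m →
    ∃ σ₁ : State,
      (∀ σ' A B, Exec mainLoop σ₁ σ' A B → ∃ A' B', Exec mainLoop σ σ' A' B' ∧
        A' + 3 = A + 4 * countAll m s + 5 * countParts (Dominates 3) m s ∧
        B' + 1 = B + countAll m s + 4 * countParts (Dominates 3) m s) ∧
      σ₁.val .x = σ.a (σ.val .k - 1) + 1 ∧ σ₁.val .y = s - 1 ∧
      σ₁.val .k = σ.val .k - 1 ∧ ∀ i < σ.val .k, σ₁.a i = σ.a i := by
  induction N with
  | zero => intro m s σ hN _ hm hms; omega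
  | succ N ih =>
    intro m s σ hN hk hm hms hx hy
    rcases Nat.lt_or_ge s (4 * m) with hs | hs
    · obtain ⟨σ₁, hrun, hrest⟩ := mainLoop_no_push hk hm hms hs hx hy
      refine ⟨σ₁, fun σ' A B hE => ⟨_, _, hrun _ _ _ hE, ?_, ?_⟩, hrest⟩ <;>
      · rw [countDominates_eq_one hm hms (by omega)]
    · obtain ⟨σ₁, hpush, d1, d2, d3, d4, d5⟩ := mainLoop_push (σ := σ) hk (by omega)
      obtain ⟨σ₂, hrun₂, e1, e2, e3, e4⟩ :=
        ih m (s - m) σ₁ (by omega) (by omega) hm (by omega) (by omega) (by omega)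
      have hk₁ : σ₁.val .k - 1 = σ.val .k := by omega
      rw [hk₁, d4] at e1
      obtain ⟨σ₃, hrun₃, f1, f2, f3, f4⟩ :=
        ih (m + 1) s σ₂ (by omega) (by omega) (by omega) (by omega) (by omega) (by omega)
      have hk₂ : σ₂.val .k = σ.val .k := by omega
      have ha : ∀ i < σ.val .k, σ₂.a i = σ.a i := fun i hi => (e4 i (by omega)).trans (d5 i hi)
      rw [hk₂] at f1 f3 f4
      rw [ha _ (by omega)] at f1
      refine ⟨σ₃, fun σ' A B hE => ?_, f1, f2, f3, fun i hi => (f4 i hi).trans (ha i hi)⟩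
      obtain ⟨A₁, B₁, hE₁, hA₁, hB₁⟩ := hrun₃ _ _ _ hE
      obtain ⟨A₂, B₂, hE₂, hA₂, hB₂⟩ := hrun₂ _ _ _ hE₁
      refine ⟨_, _, hpush _ _ _ hE₂, ?_, ?_⟩ <;>
      · rw [countAll_rec hm hms, countDominates_rec (by omega) hm (by omega)]
        omega

theorem exec_accelGen {n : ℕ} (hn : 0 < n) {σ : State} (hσ : σ.val .n = n) :
    ∃ σ', Exec accelGen σ σ' (4 * numPartitions n + 5 * numPartitionsRatio 3 n)
      (numPartitions n + 4 * numPartitionsRatio 3 n) := by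
  let v₁ := Function.update σ.val .k 1
  let v₂ := Function.update v₁ .x 1
  let v₃ := Function.update v₂ .y (v₂ .n - 1)
  obtain ⟨σ₁, hrun, -, -, hk, -⟩ :=
    mainLoop_spec (2 * n) 1 n ⟨v₃, σ.a, σ.out⟩ (by omega) (by simp [v₃, v₂, v₁]) le_rfl hn
      (by simp [v₃, v₂, v₁]) (by simp [v₃, v₂, v₁, hσ])
  have hexit : Exec mainLoop σ₁ σ₁ 0 1 := Exec.loopFalse (by
    simp [BExpr.Holds, Expr.eval, hk, v₃, v₂, v₁])
  obtain ⟨A, B, hE, hA, hB⟩ := hrun _ _ _ hexit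
  rw [numPartitions_eq_countAll, numPartitionsRatio_eq_count]
  exact ⟨σ₁, Exec.congr_cost
    (.seq (.assign _ _ _) (.seq (.assign _ _ _) (.seq (.assign _ _ _) hE)))
    (by omega) (by omega)⟩

end PartitionGen

theorem theorem6 (n : ℕ) (hn : 0 < n) (σ : PartitionGen.State)
    (hσ : σ.val PartitionGen.Var.n = (n : ℤ)) :
    (∃ σ' : PartitionGen.State,
      PartitionGen.Exec PartitionGen.accelGen σ σ'
        (4 * PartitionGen.numPartitions n + 5 * PartitionGen.numPartitionsRatio 3 n)
        (PartitionGen.numPartitions n + 4 * PartitionGen.numPartitionsRatio 3 n)) ∧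
    ∀ (σ' : PartitionGen.State) (A B : ℕ),
      PartitionGen.Exec PartitionGen.accelGen σ σ' A B →
        A = 4 * PartitionGen.numPartitions n + 5 * PartitionGen.numPartitionsRatio 3 n ∧
        B = PartitionGen.numPartitions n + 4 * PartitionGen.numPartitionsRatio 3 n := by
  obtain ⟨σ₀, h₀⟩ := PartitionGen.exec_accelGen hn hσ
  exact ⟨⟨σ₀, h₀⟩, fun σ' A B h => (h.deterministic h₀).2⟩
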